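/- Let $\Phi$ be a norm on $\mathbb{R}^N$ and let $\Phi^\circ(x)=\sup\{\xi\cdot x:\Phi(\xi)\le 1\}$ be its polar. For sets $A,B\subseteq\mathbb{R}^N$ and a point $x$ put $\mathrm{dist}(x,A)=\inf_{y\in A}\Phi^\circ(x-y)$ and $\mathrm{dist}(A,B)=\inf_{x\in A,\,y\in B}\Phi^\circ(x-y)$, with $\inf\emptyset=+\infty$. For $\eta>0$ and $C\subseteq\mathbb{R}^N$ let $$d^\eta_C(x)=-\eta\vee\bigl(\eta\wedge(\mathrm{dist}(x,C)-\mathrm{dist}(x,C^c))\bigr)$$ be the truncated signed distance to $\partial C$ (positive outside $C$, negative inside). Let $C_1\subseteq C_2\subseteq\mathbb{R}^N$, let $c_1,c_2\in\mathbb{R}$ and $\eta>0$, and for $i=1,2$ let $u_i$ be the continuous viscosity solution on $\mathbb{R}^N\times[0,\infty)$ of $$\partial_t u_i=c_i\,\Phi(Du_i)\ \text{ in }\mathbb{R}^N\times(0,\infty),\qquad u_i(\cdot,0)=d^\eta_{C_i}.$$ Put $C_i(t)=\{x: u_i(x,t)\ge 0\}$ and $\delta(t)=\mathrm{dist}(\partial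 C_1(t),\partial C_2(t))\in[0,\infty]$. Then $$\delta(t)\ \ge\ \delta(0)-t\,(c_2-c_1)\qquad\text{for every real } t \text{ with } 0\le t\le T_S:=\sup\{\tau\ge 0:\delta(\tau)>0\}\in[0,\infty]$$ (with $\sup\emptyset=0$); in particular the inequality holds up to the first contact time. -/

import Mathlib

open Set Topology
open scoped ENNReal

noncomputable section

namespace ConstSpeed

variable {N : ℕ}

/-- The polar `Φ°(x) = sup {ξ · x : Φ(ξ) ≤ 1}` of a (semi)norm `Φ` on `ℝ^N`. -/
def polar (Φ : Seminorm ℝ (EuclideanSpace ℝ (Fin N))) (x : EuclideanSpace ℝ (Fin N)) : ℝ :=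
  sSup ((fun ξ : EuclideanSpace ℝ (Fin N) => inner ℝ ξ x) '' {ξ | Φ ξ ≤ 1})

/-- The distance from a point to a set measured with `Φ°`; it is `∞` for the empty set. -/
def distPt (Φ : Seminorm ℝ (EuclideanSpace ℝ (Fin N))) (x : EuclideanSpace ℝ (Fin N))
    (A : Set (EuclideanSpace ℝ (Fin N))) : ℝ≥0∞ :=
  ⨅ y ∈ A, ENNReal.ofReal (polar Φ (x - y))

/-- The distance between two sets measured with `Φ°`; it is `∞` if one of them is empty. -/
def distSets (Φ : Seminorm ℝ (EuclideanSpace ℝ (Fin N)))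
    (A B : Set (EuclideanSpace ℝ (Fin N))) : ℝ≥0∞ :=
  ⨅ x ∈ A, ⨅ y ∈ B, ENNReal.ofReal (polar Φ (x - y))

/-- The signed `Φ°`-distance `dist(x, C) - dist(x, Cᶜ)` (positive outside `C`, negative inside),
truncated at the levels `±η`. The difference is formed in the extended reals, so that the value is
`η` everywhere for `C = ∅` and `-η` everywhere for the full space. -/
def truncDist (Φ : Seminorm ℝ (EuclideanSpace ℝ (Fin N))) (η : ℝ)
    (C : Set (EuclideanSpace ℝ (Fin N))) (x : EuclideanSpace ℝ (Fin N)) : ℝ :=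
  (max (-(η : EReal)) (min (η : EReal) ((distPt Φ x C : EReal) - (distPt Φ x Cᶜ : EReal)))).toReal

/-- The space-time domain `ℝ^N × (0, ∞)`. -/
def openDomain (N : ℕ) : Set (EuclideanSpace ℝ (Fin N) × ℝ) := univ ×ˢ Ioi 0

/-- `u` is a viscosity subsolution of `∂ₜu = c Φ(Du)` in `ℝ^N × (0, ∞)`: whenever `u - φ` has a
local maximum at `(x, t)`, `t > 0`, with `φ` of class `C²`, then `∂ₜφ ≤ c Φ(Dφ)` at `(x, t)`. -/
def IsViscositySub (Φ : Seminorm ℝ (EuclideanSpace ℝ (Fin N))) (c : ℝ)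
    (u : EuclideanSpace ℝ (Fin N) → ℝ → ℝ) : Prop :=
  ∀ φ : EuclideanSpace ℝ (Fin N) × ℝ → ℝ, ContDiffOn ℝ 2 φ (openDomain N) →
    ∀ (x : EuclideanSpace ℝ (Fin N)) (t : ℝ), 0 < t →
      IsLocalMax (fun z : EuclideanSpace ℝ (Fin N) × ℝ => u z.1 z.2 - φ z) (x, t) →
        deriv (fun τ => φ (x, τ)) t ≤ c * Φ (gradient (fun y => φ (y, t)) x)

/-- `u` is a viscosity supersolution of `∂ₜu = c Φ(Du)` in `ℝ^N × (0, ∞)`: whenever `u - φ` has a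
local minimum at `(x, t)`, `t > 0`, with `φ` of class `C²`, then `∂ₜφ ≥ c Φ(Dφ)` at `(x, t)`. -/
def IsViscositySuper (Φ : Seminorm ℝ (EuclideanSpace ℝ (Fin N))) (c : ℝ)
    (u : EuclideanSpace ℝ (Fin N) → ℝ → ℝ) : Prop :=
  ∀ φ : EuclideanSpace ℝ (Fin N) × ℝ → ℝ, ContDiffOn ℝ 2 φ (openDomain N) →
    ∀ (x : EuclideanSpace ℝ (Fin N)) (t : ℝ), 0 < t →
      IsLocalMin (fun z : EuclideanSpace ℝ (Fin N) × ℝ => u z.1 z.2 - φ z) (x, t) →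
        c * Φ (gradient (fun y => φ (y, t)) x) ≤ deriv (fun τ => φ (x, τ)) t

/-- `u` is a (continuous) viscosity solution of the Cauchy problem `∂ₜu = c Φ(Du)` in
`ℝ^N × (0, ∞)`, `u(·, 0) = u₀`. Only the values `u x t` with `t ≥ 0` matter. -/
structure IsViscositySolution (Φ : Seminorm ℝ (EuclideanSpace ℝ (Fin N))) (c : ℝ)
    (u₀ : EuclideanSpace ℝ (Fin N) → ℝ) (u : EuclideanSpace ℝ (Fin N) → ℝ → ℝ) : Prop where
  continuousOn : ContinuousOn (fun z : EuclideanSpace ℝ (Fin N) × ℝ => u z.1 z.2) (univ ×ˢ Ici 0)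
  initial : ∀ x, u x 0 = u₀ x
  sub : IsViscositySub Φ c u
  super : IsViscositySuper Φ c u

/-- The evolving set `{x : u(x, t) ≥ 0}`. -/
def levelSet (u : EuclideanSpace ℝ (Fin N) → ℝ → ℝ) (t : ℝ) : Set (EuclideanSpace ℝ (Fin N)) :=
  {x | 0 ≤ u x t}

/-- `δ(t)`, the `Φ°`-distance between the boundaries of the two evolving sets at time `t`. -/
def frontDist (Φ : Seminorm ℝ (EuclideanSpace ℝ (Fin N)))
    (u₁ u₂ : EuclideanSpace ℝ (Fin N) → ℝ → ℝ) (t : ℝ) : ℝ≥0∞ :=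
  distSets Φ (frontier (levelSet u₁ t)) (frontier (levelSet u₂ t))

/-- `sup {τ ≥ 0 : δ(τ) > 0}`, with values in `[0, ∞]`. -/
def contactTime (δ : ℝ → ℝ≥0∞) : ℝ≥0∞ :=
  ⨆ (τ : ℝ) (_ : 0 ≤ τ ∧ 0 < δ τ), ENNReal.ofReal τ

end ConstSpeed

end

namespace ConstSpeed

variable {N : ℕ}

/-! The Hopf–Lax picture holds: for `c ≥ 0` the value `u x t` is governed by the maximum of `u · 0`
over the `Φ°`-ball of radius `c t` about `x`, for `c ≤ 0` by the minimum over the ball of radius `-c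
t`. Only upper bounds for subsolutions are needed; the supersolution `u₁` enters through `-u₁`, with
speed `-c₁`.

Since `C₁ ⊆ C₂`, the initial data give `K₂ ⊆ K₁`, where `Kᵢ = {uᵢ(·, 0) ≥ 0}`. Given `x` with `u₂ x
t ≥ 0` and `y` with `u₁ y t < 0`, these bounds trace the pair back to `x' ∈ K₂` and `y' ∉ K₁`,
changing its distance by at most `c₂ t - c₁ t` (`exists_pair_of_displacement`). The segment from
`x'` to `y'` crosses both initial fronts, so `δ(0) ≤ Φ°(y - x) + t (c₂ - c₁)`; the infimum over the
fronts at time `t` concludes.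

Both bounds come from one comparison result, `subsolution_le`, for a sublinear `H`: take `H = c Φ`
if `c ≥ 0`, and if `c ≤ 0` a linear `H ≥ c Φ`. -/

/-! ### Barriers and finite speed of propagation -/

theorem sublinear_sum_smul_le {E ι : Type*} [AddCommGroup E] [Module ℝ E] {H : E → ℝ}
    (hsmul : ∀ r : ℝ, 0 ≤ r → ∀ ξ, H (r • ξ) = r * H ξ) (hadd : ∀ ξ ζ, H (ξ + ζ) ≤ H ξ + H ζ)
    (s : Finset ι) (w : ι → ℝ) (hw : ∀ i ∈ s, 0 ≤ w i) (ξ : ι → E) :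
    H (∑ i ∈ s, w i • ξ i) ≤ ∑ i ∈ s, w i * H (ξ i) := by
  classical
  induction s using Finset.induction_on with
  | empty => simpa using (hsmul 0 le_rfl 0).le
  | insert i s hi ih =>
    rw [Finset.sum_insert hi, Finset.sum_insert hi]
    refine (hadd _ _).trans (add_le_add ?_ (ih fun j hj => hw j (Finset.mem_insert_of_mem hj)))
    rw [hsmul _ (hw i (Finset.mem_insert_self i s))]

/-- Where `f ≥ b`, the quotient `(f - b) / G` is continuous on a compact set, hence bounded. This
supplies the slope `k` of the barrier. -/
theorem exists_lt_add_mul_of_isCompact {X : Type*} [TopologicalSpace X] [T2Space X] {K : Set X}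
    (hK : IsCompact K) {f G : X → ℝ} {b : ℝ} (hf : ContinuousOn f K) (hG : Continuous G)
    (hG0 : ∀ z, 0 ≤ G z) (h : ∀ z ∈ K, b ≤ f z → 0 < G z) :
    ∃ k : ℝ, 0 ≤ k ∧ ∀ z ∈ K, f z < b + k * G z := by
  have hS : IsCompact (K ∩ f ⁻¹' Ici b) :=
    hK.of_isClosed_subset (hf.preimage_isClosed_of_isClosed hK.isClosed isClosed_Ici)
      inter_subset_left
  have hpos : ∀ z ∈ K ∩ f ⁻¹' Ici b, 0 < G z := fun z hz => h z hz.1 hz.2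
  obtain ⟨m, hm⟩ := hS.bddAbove_image (f := fun z => (f z - b) / G z)
    (((hf.mono inter_subset_left).sub continuousOn_const).div hG.continuousOn
      fun z hz => (hpos z hz).ne')
  refine ⟨max m 0 + 1, by positivity, fun z hz => ?_⟩
  by_cases hb : b ≤ f z
  · have hGz := hpos z ⟨hz, hb⟩
    have h1 : (f z - b) / G z ≤ m := hm ⟨z, ⟨hz, hb⟩, rfl⟩
    rw [div_le_iff₀ hGz] at h1
    nlinarith [le_max_left m 0]
  · have : 0 ≤ (max m 0 + 1) * G z := mul_nonneg (by positivity) (hG0 z)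
    linarith

/-- The affine function `z ↦ ξ · (x - x₀) + a (t - t₀)` on space-time, for `p = (ξ, a)`. -/
noncomputable def spaceTimeForm (x₀ : EuclideanSpace ℝ (Fin N)) (t₀ : ℝ)
    (p z : EuclideanSpace ℝ (Fin N) × ℝ) : ℝ :=
  inner ℝ p.1 (z.1 - x₀) + p.2 * (z.2 - t₀)

/-- The barrier `ε t + k ∑ₚ g(ξₚ · (x - x₀) + aₚ (t - t₀))`, where `g` is a smooth nondecreasing
function that vanishes exactly on `(-∞, 0]`. -/
noncomputable def barrier (x₀ : EuclideanSpace ℝ (Fin N)) (t₀ ε k : ℝ)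
    (P : Finset (EuclideanSpace ℝ (Fin N) × ℝ)) (z : EuclideanSpace ℝ (Fin N) × ℝ) : ℝ :=
  ε * z.2 + k * ∑ p ∈ P, expNegInvGlue (spaceTimeForm x₀ t₀ p z)

theorem contDiff_spaceTimeForm (x₀ : EuclideanSpace ℝ (Fin N)) (t₀ : ℝ)
    (p : EuclideanSpace ℝ (Fin N) × ℝ) : ContDiff ℝ 2 (spaceTimeForm x₀ t₀ p) := by
  unfold spaceTimeForm
  exact (contDiff_const.inner ℝ (contDiff_fst.sub contDiff_const)).add
    (contDiff_const.mul (contDiff_snd.sub contDiff_const))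

theorem contDiff_expNegInvGlue_two : ContDiff ℝ 2 expNegInvGlue :=
  expNegInvGlue.contDiff (n := 2)

theorem contDiff_barrier (x₀ : EuclideanSpace ℝ (Fin N)) (t₀ ε k : ℝ)
    (P : Finset (EuclideanSpace ℝ (Fin N) × ℝ)) : ContDiff ℝ 2 (barrier x₀ t₀ ε k P) := by
  unfold barrier
  exact (contDiff_const.mul contDiff_snd).add (contDiff_const.mul
    (ContDiff.sum fun p _ => contDiff_expNegInvGlue_two.comp (contDiff_spaceTimeForm x₀ t₀ p)))

theorem hasDerivAt_expNegInvGlue (s : ℝ) :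
    HasDerivAt expNegInvGlue (deriv expNegInvGlue s) s :=
  (contDiff_expNegInvGlue_two.differentiable (by norm_num) s).hasDerivAt

theorem deriv_expNegInvGlue_nonneg (s : ℝ) : 0 ≤ deriv expNegInvGlue s :=
  expNegInvGlue.monotone.deriv_nonneg

theorem deriv_barrier_time (x₀ : EuclideanSpace ℝ (Fin N)) (t₀ ε k : ℝ)
    (P : Finset (EuclideanSpace ℝ (Fin N) × ℝ)) (x : EuclideanSpace ℝ (Fin N)) (t : ℝ) :
    deriv (fun τ => barrier x₀ t₀ ε k P (x, τ)) t =
      ε + k * ∑ p ∈ P, deriv expNegInvGlue (spaceTimeForm x₀ t₀ p (x, t)) * p.2 := by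
  have h : ∀ p ∈ P, HasDerivAt (fun τ => expNegInvGlue (spaceTimeForm x₀ t₀ p (x, τ)))
      (deriv expNegInvGlue (spaceTimeForm x₀ t₀ p (x, t)) * p.2) t := by
    intro p _
    have h1 : HasDerivAt (fun τ => spaceTimeForm x₀ t₀ p (x, τ)) p.2 t := by
      simpa [spaceTimeForm] using
        (((hasDerivAt_id t).sub_const t₀).const_mul p.2).const_add (inner ℝ p.1 (x - x₀))
    exact (hasDerivAt_expNegInvGlue _).comp t h1
  simpa [barrier] using
    (((hasDerivAt_id t).const_mul ε).fun_add ((HasDerivAt.fun_sum h).const_mul k)).deriv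

theorem gradient_barrier_space (x₀ : EuclideanSpace ℝ (Fin N)) (t₀ ε k : ℝ)
    (P : Finset (EuclideanSpace ℝ (Fin N) × ℝ)) (x : EuclideanSpace ℝ (Fin N)) (t : ℝ) :
    gradient (fun y => barrier x₀ t₀ ε k P (y, t)) x =
      ∑ p ∈ P, (k * deriv expNegInvGlue (spaceTimeForm x₀ t₀ p (x, t))) • p.1 := by
  have h : ∀ p ∈ P, HasFDerivAt (fun y => expNegInvGlue (spaceTimeForm x₀ t₀ p (y, t)))
      (deriv expNegInvGlue (spaceTimeForm x₀ t₀ p (x, t)) • innerSL ℝ p.1) x := by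
    intro p _
    have h1 : HasFDerivAt (fun y => spaceTimeForm x₀ t₀ p (y, t)) (innerSL ℝ p.1) x := by
      have := (((innerSL ℝ p.1).hasFDerivAt (x := x)).sub_const (innerSL ℝ p.1 x₀)).add_const
        (p.2 * (t - t₀))
      simpa [spaceTimeForm, inner_sub_right] using this
    exact (hasDerivAt_expNegInvGlue _).comp_hasFDerivAt x h1
  refine HasGradientAt.gradient ?_
  rw [hasGradientAt_iff_hasFDerivAt]
  have h2 := ((HasFDerivAt.fun_sum h).const_mul k).const_add (ε * t)
  refine h2.congr_fderiv ?_
  ext v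
  simp [Finset.mul_sum, mul_assoc]

/-- Finite speed of propagation: a subsolution of `∂ₜu = H(Du)`, `H` sublinear, is at most `M` at
`(x₀, t₀)` if every initial point with a value above `M` is separated from the backward cone. -/
theorem subsolution_le {H : EuclideanSpace ℝ (Fin N) → ℝ}
    (hsmul : ∀ r : ℝ, 0 ≤ r → ∀ ξ, H (r • ξ) = r * H ξ) (hadd : ∀ ξ ζ, H (ξ + ζ) ≤ H ξ + H ζ)
    {L : ℝ} (hL : ∀ ξ, |H ξ| ≤ L * ‖ξ‖)
    {u : EuclideanSpace ℝ (Fin N) → ℝ → ℝ}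
    (hu : ContinuousOn (fun z : EuclideanSpace ℝ (Fin N) × ℝ => u z.1 z.2) (univ ×ˢ Ici 0))
    (hsub : ∀ φ : EuclideanSpace ℝ (Fin N) × ℝ → ℝ, ContDiffOn ℝ 2 φ (openDomain N) →
      ∀ (x : EuclideanSpace ℝ (Fin N)) (t : ℝ), 0 < t →
        IsLocalMax (fun z : EuclideanSpace ℝ (Fin N) × ℝ => u z.1 z.2 - φ z) (x, t) →
          deriv (fun τ => φ (x, τ)) t ≤ H (gradient (fun y => φ (y, t)) x))
    {x₀ : EuclideanSpace ℝ (Fin N)} {t₀ M : ℝ} (ht₀ : 0 ≤ t₀)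
    (hM : ∀ y, M < u y 0 → ∃ ξ, t₀ * H ξ < inner ℝ ξ (y - x₀)) : u x₀ t₀ ≤ M := by
  by_contra! hlt
  -- The term `ε t` makes the barrier a strict supersolution; `ε` is small enough that `u - barrier`
  -- still exceeds `M + ε` at `(x₀, t₀)`.
  obtain ⟨ε, hε, hεlt⟩ : ∃ ε : ℝ, 0 < ε ∧ M + ε + ε * t₀ < u x₀ t₀ := by
    refine ⟨(u x₀ t₀ - M) / (2 * (1 + t₀)), by apply div_pos <;> linarith, ?_⟩
    have : (u x₀ t₀ - M) / (2 * (1 + t₀)) * (1 + t₀) = (u x₀ t₀ - M) / 2 := by field_simp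
    linarith
  set T := t₀ + 1 with hT
  -- With `R > |L| T`, the form with `ξ = x - x₀`, `a = H ξ` is positive on the lateral boundary:
  -- `R² > |L| R T`.
  set R := |L| * T + 1 with hR
  have hRpos : 0 < R := by positivity
  set Q : Set (EuclideanSpace ℝ (Fin N) × ℝ) := Metric.closedBall x₀ R ×ˢ Icc 0 T with hQ
  set U : Set (EuclideanSpace ℝ (Fin N) × ℝ) := Metric.ball x₀ R ×ˢ Ioo 0 T with hU
  have hUo : IsOpen U := Metric.isOpen_ball.prod isOpen_Ioo
  have hUQ : U ⊆ Q := prod_mono Metric.ball_subset_closedBall Ioo_subset_Icc_self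
  have hQc : IsCompact Q := (isCompact_closedBall x₀ R).prod isCompact_Icc
  have hEc : IsCompact (Q \ U) := hQc.diff hUo
  have huQ : ContinuousOn (fun z : EuclideanSpace ℝ (Fin N) × ℝ => u z.1 z.2) Q :=
    hu.mono (prod_mono (subset_univ _) Icc_subset_Ici_self)
  have huE := huQ.mono (sdiff_subset (t := U))
  have hsep : ∀ z ∈ Q \ U, M + ε ≤ u z.1 z.2 → ∃ p : EuclideanSpace ℝ (Fin N) × ℝ,
      H p.1 ≤ p.2 ∧ 0 < spaceTimeForm x₀ t₀ p z := by
    rintro ⟨x, t⟩ ⟨⟨hx, h0t, htT⟩, hnU⟩ hval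
    simp only at hval h0t htT
    rcases h0t.eq_or_lt with rfl | h0t
    · obtain ⟨ξ, hξ⟩ := hM x (by linarith)
      exact ⟨(ξ, H ξ), le_rfl, by simp only [spaceTimeForm]; linarith⟩
    rcases htT.eq_or_lt with rfl | htT
    -- The form `t - t₀` equals `1` on the top face, which lies beyond `t₀`.
    · refine ⟨(0, 1), ?_, by simp [spaceTimeForm, hT]⟩
      have := hsmul 0 le_rfl 0
      simp only [zero_smul, zero_mul] at this
      simp [this]
    have hxR : ‖x - x₀‖ = R := by
      rw [← dist_eq_norm]
      refine le_antisymm hx (not_lt.1 fun hlt => hnU ⟨hlt, h0t, htT⟩)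
    refine ⟨(x - x₀, H (x - x₀)), le_rfl, ?_⟩
    have h1 : |H (x - x₀) * (t - t₀)| ≤ (|L| * R) * T := by
      rw [abs_mul]
      refine mul_le_mul ((hL _).trans ?_) ?_ (abs_nonneg _) (by positivity)
      · rw [hxR]; exact mul_le_mul_of_nonneg_right (le_abs_self L) hRpos.le
      · rw [abs_le]; constructor <;> linarith
    have h2 := (abs_le.1 h1).1
    simp only [spaceTimeForm, real_inner_self_eq_norm_sq, hxR]
    nlinarith
  obtain ⟨P, hP, hPsep⟩ : ∃ P : Finset (EuclideanSpace ℝ (Fin N) × ℝ), (∀ p ∈ P, H p.1 ≤ p.2) ∧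
      ∀ z ∈ Q \ U, M + ε ≤ u z.1 z.2 → ∃ p ∈ P, 0 < spaceTimeForm x₀ t₀ p z := by
    classical
    have hS : IsCompact ((Q \ U) ∩ (fun z => u z.1 z.2) ⁻¹' Ici (M + ε)) :=
      hEc.of_isClosed_subset (huE.preimage_isClosed_of_isClosed hEc.isClosed isClosed_Ici)
        inter_subset_left
    obtain ⟨F, hF⟩ := hS.elim_finite_subcover
      (fun p : {p : EuclideanSpace ℝ (Fin N) × ℝ // H p.1 ≤ p.2} =>
        {z | 0 < spaceTimeForm x₀ t₀ p z})
      (fun p => isOpen_lt continuous_const (contDiff_spaceTimeForm x₀ t₀ p).continuous)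
      (fun z hz => by
        obtain ⟨p, hp, hpz⟩ := hsep z hz.1 hz.2
        exact mem_iUnion.2 ⟨⟨p, hp⟩, hpz⟩)
    refine ⟨F.image Subtype.val, ?_, fun z hz hv => ?_⟩
    · intro p hp
      obtain ⟨q, _, rfl⟩ := Finset.mem_image.1 hp
      exact q.2
    · obtain ⟨p, hpF, hpz⟩ := mem_iUnion₂.1 (hF ⟨hz, hv⟩)
      exact ⟨p, Finset.mem_image_of_mem _ hpF, hpz⟩
  obtain ⟨k, hk, hkE⟩ := exists_lt_add_mul_of_isCompact hEc huE
    (G := fun z => ∑ p ∈ P, expNegInvGlue (spaceTimeForm x₀ t₀ p z))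
    (continuous_finsetSum _ fun p _ => contDiff_expNegInvGlue_two.continuous.comp
      (contDiff_spaceTimeForm x₀ t₀ p).continuous)
    (fun z => Finset.sum_nonneg fun p _ => expNegInvGlue.nonneg _)
    (fun z hz hv => by
      obtain ⟨p, hp, hpz⟩ := hPsep z hz hv
      exact Finset.sum_pos' (fun p _ => expNegInvGlue.nonneg _)
        ⟨p, hp, expNegInvGlue.pos_of_pos hpz⟩)
  have hφ := contDiff_barrier x₀ t₀ ε k P
  have hmemQ : (x₀, t₀) ∈ Q :=
    ⟨Metric.mem_closedBall_self hRpos.le, ht₀, by simp [hT]⟩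
  obtain ⟨⟨x, t⟩, hzQ, hmax⟩ := hQc.exists_isMaxOn ⟨_, hmemQ⟩
    (huQ.sub hφ.continuous.continuousOn)
  have hge : M + ε < u x t - barrier x₀ t₀ ε k P (x, t) := by
    refine lt_of_lt_of_le ?_ (hmax hmemQ)
    simp [barrier, spaceTimeForm]
    linarith
  have hzU : (x, t) ∈ U := by
    by_contra hnU
    have h1 := hkE (x, t) ⟨hzQ, hnU⟩
    have h2 : 0 ≤ ε * t := mul_nonneg hε.le hzQ.2.1
    simp only [barrier] at hge h1
    linarith
  have hloc := hmax.isLocalMax (Filter.mem_of_superset (hUo.mem_nhds hzU) hUQ)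
  have h := hsub _ hφ.contDiffOn x t hzU.2.1 hloc
  -- Sublinearity and `H ξₚ ≤ aₚ` bound `H` of the gradient by the time derivative minus `ε`,
  -- contradicting the subsolution test.
  rw [deriv_barrier_time, gradient_barrier_space] at h
  have h1 := sublinear_sum_smul_le hsmul hadd P
    (fun p => k * deriv expNegInvGlue (spaceTimeForm x₀ t₀ p (x, t)))
    (fun p _ => mul_nonneg hk (deriv_expNegInvGlue_nonneg _)) (fun p => p.1)
  have h2 : ∑ p ∈ P, k * deriv expNegInvGlue (spaceTimeForm x₀ t₀ p (x, t)) * H p.1 ≤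
      ∑ p ∈ P, k * deriv expNegInvGlue (spaceTimeForm x₀ t₀ p (x, t)) * p.2 :=
    Finset.sum_le_sum fun p hp => mul_le_mul_of_nonneg_left (hP p hp)
      (mul_nonneg hk (deriv_expNegInvGlue_nonneg _))
  rw [Finset.mul_sum] at h
  simp only [mul_assoc] at h h1 h2
  linarith

/-! ### The norm and its polar -/

theorem seminorm_continuous (Φ : Seminorm ℝ (EuclideanSpace ℝ (Fin N))) : Continuous Φ := by
  have h : ConvexOn ℝ univ Φ := Φ.convexOn
  simpa [continuousOn_univ] using h.continuousOn isOpen_univ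

theorem exists_seminorm_le (Φ : Seminorm ℝ (EuclideanSpace ℝ (Fin N))) :
    ∃ L : ℝ, 0 ≤ L ∧ ∀ ξ, Φ ξ ≤ L * ‖ξ‖ := by
  obtain ⟨L, hL, h⟩ := Φ.bound_of_continuous_normedSpace (seminorm_continuous Φ)
  exact ⟨L, hL.le, h⟩

theorem exists_norm_le_seminorm {Φ : Seminorm ℝ (EuclideanSpace ℝ (Fin N))}
    (hΦ : ∀ p : EuclideanSpace ℝ (Fin N), p ≠ 0 → 0 < Φ p) :
    ∃ C : ℝ, 0 ≤ C ∧ ∀ ξ, ‖ξ‖ ≤ C * Φ ξ := by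
  obtain ⟨m, hm, h⟩ := (isCompact_sphere (0 : EuclideanSpace ℝ (Fin N)) 1).exists_forall_le'
    (seminorm_continuous Φ).continuousOn (a := 0) (fun b hb => hΦ b (by
      rintro rfl
      simp at hb))
  refine ⟨m⁻¹, by positivity, fun ξ => ?_⟩
  rcases eq_or_ne ξ 0 with rfl | hξ
  · simp
  have hn : 0 < ‖ξ‖ := norm_pos_iff.2 hξ
  have h1 := h (‖ξ‖⁻¹ • ξ) (by simp [norm_smul, hn.ne'])
  rw [map_smul_eq_mul, norm_inv, norm_norm, inv_mul_eq_div, le_div_iff₀ hn] at h1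
  rw [inv_mul_eq_div, le_div_iff₀ hm]
  linarith

theorem polar_nonneg (Φ : Seminorm ℝ (EuclideanSpace ℝ (Fin N))) (x : EuclideanSpace ℝ (Fin N)) :
    0 ≤ polar Φ x := by
  by_cases hb : BddAbove ((fun ξ : EuclideanSpace ℝ (Fin N) => inner ℝ ξ x) '' {ξ | Φ ξ ≤ 1})
  · exact le_csSup hb ⟨0, by simp, by simp⟩
  -- An unbounded `sSup` has default value `0`.
  · exact (Real.sSup_of_not_bddAbove hb).ge

theorem polar_le {Φ : Seminorm ℝ (EuclideanSpace ℝ (Fin N))} {x : EuclideanSpace ℝ (Fin N)}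
    {r : ℝ} (hr : 0 ≤ r) (h : ∀ ξ, inner ℝ ξ x ≤ r * Φ ξ) : polar Φ x ≤ r := by
  refine csSup_le ⟨_, 0, by simp, rfl⟩ ?_
  rintro _ ⟨ξ, hξ, rfl⟩
  exact (h ξ).trans (mul_le_of_le_one_right hr hξ)

theorem inner_le_polar_mul {Φ : Seminorm ℝ (EuclideanSpace ℝ (Fin N))}
    (hΦ : ∀ p : EuclideanSpace ℝ (Fin N), p ≠ 0 → 0 < Φ p) (x ξ : EuclideanSpace ℝ (Fin N)) :
    inner ℝ ξ x ≤ polar Φ x * Φ ξ := by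
  rcases eq_or_ne ξ 0 with rfl | hξ
  · simp
  obtain ⟨C, hC, hCb⟩ := exists_norm_le_seminorm hΦ
  have hb : BddAbove ((fun ξ : EuclideanSpace ℝ (Fin N) => inner ℝ ξ x) '' {ξ | Φ ξ ≤ 1}) := by
    refine ⟨C * ‖x‖, ?_⟩
    rintro _ ⟨ζ, hζ, rfl⟩
    refine (real_inner_le_norm _ _).trans (mul_le_mul_of_nonneg_right ?_ (norm_nonneg x))
    exact (hCb ζ).trans (mul_le_of_le_one_right hC hζ)
  have hp := hΦ ξ hξ
  have h1 : inner ℝ ((Φ ξ)⁻¹ • ξ) x ≤ polar Φ x := by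
    refine le_csSup hb ⟨_, ?_, rfl⟩
    simp [map_smul_eq_mul, abs_of_pos hp, hp.ne']
  rw [real_inner_smul_left, inv_mul_eq_div, div_le_iff₀ hp] at h1
  exact h1

theorem polar_le_iff {Φ : Seminorm ℝ (EuclideanSpace ℝ (Fin N))}
    (hΦ : ∀ p : EuclideanSpace ℝ (Fin N), p ≠ 0 → 0 < Φ p) {x : EuclideanSpace ℝ (Fin N)}
    {r : ℝ} (hr : 0 ≤ r) : polar Φ x ≤ r ↔ ∀ ξ, inner ℝ ξ x ≤ r * Φ ξ :=
  ⟨fun h ξ => (inner_le_polar_mul hΦ x ξ).trans (mul_le_mul_of_nonneg_right h (apply_nonneg Φ ξ)),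
    polar_le hr⟩

theorem polar_add_le {Φ : Seminorm ℝ (EuclideanSpace ℝ (Fin N))}
    (hΦ : ∀ p : EuclideanSpace ℝ (Fin N), p ≠ 0 → 0 < Φ p) (x y : EuclideanSpace ℝ (Fin N)) :
    polar Φ (x + y) ≤ polar Φ x + polar Φ y := by
  refine polar_le (add_nonneg (polar_nonneg Φ x) (polar_nonneg Φ y)) fun ξ => ?_
  rw [inner_add_right, add_mul]
  exact add_le_add (inner_le_polar_mul hΦ x ξ) (inner_le_polar_mul hΦ y ξ)

theorem polar_sub_le {Φ : Seminorm ℝ (EuclideanSpace ℝ (Fin N))}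
    (hΦ : ∀ p : EuclideanSpace ℝ (Fin N), p ≠ 0 → 0 < Φ p) (x y z : EuclideanSpace ℝ (Fin N)) :
    polar Φ (x - z) ≤ polar Φ (x - y) + polar Φ (y - z) := by
  simpa using polar_add_le hΦ (x - y) (y - z)

theorem polar_neg {Φ : Seminorm ℝ (EuclideanSpace ℝ (Fin N))}
    (hΦ : ∀ p : EuclideanSpace ℝ (Fin N), p ≠ 0 → 0 < Φ p) (x : EuclideanSpace ℝ (Fin N)) :
    polar Φ (-x) = polar Φ x := by
  have h : ∀ y, polar Φ (-y) ≤ polar Φ y := fun y => polar_le (polar_nonneg Φ y) fun ξ => by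
    simpa [inner_neg_left] using inner_le_polar_mul hΦ y (-ξ)
  exact le_antisymm (h x) (by simpa using h (-x))

theorem polar_sub_comm {Φ : Seminorm ℝ (EuclideanSpace ℝ (Fin N))}
    (hΦ : ∀ p : EuclideanSpace ℝ (Fin N), p ≠ 0 → 0 < Φ p) (x y : EuclideanSpace ℝ (Fin N)) :
    polar Φ (x - y) = polar Φ (y - x) := by
  rw [← polar_neg hΦ, neg_sub]

theorem polar_smul_le {Φ : Seminorm ℝ (EuclideanSpace ℝ (Fin N))}
    (hΦ : ∀ p : EuclideanSpace ℝ (Fin N), p ≠ 0 → 0 < Φ p) {r : ℝ} (hr : 0 ≤ r)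
    (x : EuclideanSpace ℝ (Fin N)) : polar Φ (r • x) ≤ r * polar Φ x := by
  refine polar_le (mul_nonneg hr (polar_nonneg Φ x)) fun ξ => ?_
  rw [real_inner_smul_right, mul_assoc]
  exact mul_le_mul_of_nonneg_left (inner_le_polar_mul hΦ x ξ) hr

theorem exists_polar_le_norm {Φ : Seminorm ℝ (EuclideanSpace ℝ (Fin N))}
    (hΦ : ∀ p : EuclideanSpace ℝ (Fin N), p ≠ 0 → 0 < Φ p) :
    ∃ C : ℝ, 0 ≤ C ∧ ∀ x, polar Φ x ≤ C * ‖x‖ := by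
  obtain ⟨C, hC, hCb⟩ := exists_norm_le_seminorm hΦ
  refine ⟨C, hC, fun x => polar_le (by positivity) fun ξ => (real_inner_le_norm _ _).trans ?_⟩
  nlinarith [hCb ξ, norm_nonneg x]

theorem exists_norm_le_polar {Φ : Seminorm ℝ (EuclideanSpace ℝ (Fin N))}
    (hΦ : ∀ p : EuclideanSpace ℝ (Fin N), p ≠ 0 → 0 < Φ p) :
    ∃ C : ℝ, 0 ≤ C ∧ ∀ x, ‖x‖ ≤ C * polar Φ x := by
  obtain ⟨L, hL, hLb⟩ := exists_seminorm_le Φ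
  refine ⟨L, hL, fun x => ?_⟩
  rcases eq_or_ne x 0 with rfl | hx
  · simpa using mul_nonneg hL (polar_nonneg Φ _)
  have hn : 0 < ‖x‖ := norm_pos_iff.2 hx
  have h := inner_le_polar_mul hΦ x x
  rw [real_inner_self_eq_norm_sq] at h
  have := mul_le_mul_of_nonneg_left (hLb x) (polar_nonneg Φ x)
  nlinarith

theorem isCompact_polar_ball {Φ : Seminorm ℝ (EuclideanSpace ℝ (Fin N))}
    (hΦ : ∀ p : EuclideanSpace ℝ (Fin N), p ≠ 0 → 0 < Φ p) (x : EuclideanSpace ℝ (Fin N))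
    {r : ℝ} (hr : 0 ≤ r) : IsCompact {y | polar Φ (y - x) ≤ r} := by
  obtain ⟨C, hC, hCb⟩ := exists_norm_le_polar hΦ
  refine (isCompact_closedBall x (C * r)).of_isClosed_subset ?_ fun y hy => ?_
  · simp only [polar_le_iff hΦ hr, ofPred_forall]
    exact isClosed_iInter fun ξ => isClosed_le (by fun_prop) (by fun_prop)
  · rw [mem_closedBall_iff_norm]
    exact (hCb _).trans (mul_le_mul_of_nonneg_left hy hC)

/-! ### One-sided Hopf–Lax bounds -/

theorem continuous_slice {u : EuclideanSpace ℝ (Fin N) → ℝ → ℝ}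
    (hu : ContinuousOn (fun z : EuclideanSpace ℝ (Fin N) × ℝ => u z.1 z.2) (univ ×ˢ Ici 0))
    {t : ℝ} (ht : 0 ≤ t) : Continuous fun x => u x t := by
  exact hu.comp_continuous (f := fun x => (x, t)) (by fun_prop) fun x => ⟨mem_univ x, ht⟩

/-- Expansion: for `c ≥ 0`, a value of a subsolution is dominated by an initial value at a point
within `Φ°`-distance `c t`. -/
theorem exists_le_initial_of_sub {Φ : Seminorm ℝ (EuclideanSpace ℝ (Fin N))}
    (hΦ : ∀ p : EuclideanSpace ℝ (Fin N), p ≠ 0 → 0 < Φ p) {c : ℝ} (hc : 0 ≤ c)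
    {u : EuclideanSpace ℝ (Fin N) → ℝ → ℝ}
    (hu : ContinuousOn (fun z : EuclideanSpace ℝ (Fin N) × ℝ => u z.1 z.2) (univ ×ˢ Ici 0))
    (hsub : IsViscositySub Φ c u) (x : EuclideanSpace ℝ (Fin N)) {t : ℝ} (ht : 0 ≤ t) :
    ∃ y, polar Φ (y - x) ≤ c * t ∧ u x t ≤ u y 0 := by
  have hr : 0 ≤ c * t := mul_nonneg hc ht
  obtain ⟨y, hy, hmax⟩ := (isCompact_polar_ball hΦ x hr).exists_isMaxOn
    ⟨x, by simpa using polar_le hr fun ξ => by simpa using mul_nonneg hr (apply_nonneg Φ ξ)⟩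
    (continuous_slice hu le_rfl).continuousOn
  refine ⟨y, hy, ?_⟩
  obtain ⟨L, hL, hLb⟩ := exists_seminorm_le Φ
  refine subsolution_le (H := fun ξ => c * Φ ξ) (L := c * L) ?_ ?_ ?_ hu hsub ht ?_
  · intro r hr ξ
    rw [map_smul_eq_mul, Real.norm_of_nonneg hr]; ring
  · intro ξ ζ
    rw [← mul_add]
    exact mul_le_mul_of_nonneg_left (map_add_le_add Φ ξ ζ) hc
  · intro ξ
    rw [abs_of_nonneg (mul_nonneg hc (apply_nonneg Φ ξ)), mul_assoc]
    exact mul_le_mul_of_nonneg_left (hLb ξ) hc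
  · intro z hz
    -- Failure of separation by every `ξ` puts `z` in the polar ball, where `y` is a maximizer.
    by_contra! hcon
    refine absurd (hmax (a := z) (polar_le hr fun ξ => (hcon ξ).trans_eq (by ring))) ?_
    simpa using hz

/-- Contraction: for `c ≤ 0`, a value of a subsolution is dominated by every initial value within
`Φ°`-distance `-c t`. -/
theorem le_initial_of_sub {Φ : Seminorm ℝ (EuclideanSpace ℝ (Fin N))}
    (hΦ : ∀ p : EuclideanSpace ℝ (Fin N), p ≠ 0 → 0 < Φ p) {c : ℝ} (hc : c ≤ 0)
    {u : EuclideanSpace ℝ (Fin N) → ℝ → ℝ}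
    (hu : ContinuousOn (fun z : EuclideanSpace ℝ (Fin N) × ℝ => u z.1 z.2) (univ ×ˢ Ici 0))
    (hsub : IsViscositySub Φ c u) {x y : EuclideanSpace ℝ (Fin N)} {t : ℝ} (ht : 0 ≤ t)
    (hy : polar Φ (y - x) ≤ -c * t) : u x t ≤ u y 0 := by
  rcases ht.eq_or_lt with rfl | ht
  · obtain ⟨C, hC, hCb⟩ := exists_norm_le_polar hΦ
    have h := (hCb (y - x)).trans (mul_le_mul_of_nonneg_left hy hC)
    have : y = x := by simpa [sub_eq_zero] using h
    rw [this]
  set v := t⁻¹ • (y - x) with hv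
  have htv : t • v = y - x := by rw [hv, smul_smul, mul_inv_cancel₀ ht.ne', one_smul]
  have hvΦ : ∀ ξ, inner ℝ ξ v ≤ -c * Φ ξ := by
    refine (polar_le_iff hΦ (by linarith)).1 ((polar_smul_le hΦ (by positivity) _).trans ?_)
    rw [inv_mul_eq_div, div_le_iff₀ ht]
    exact hy
  -- As `Φ°(v) ≤ -c`, one has `c Φ ξ ≤ ξ · v`, so `u` is a subsolution of a transport equation,
  -- whose backward cone meets time `0` only at `y`.
  refine subsolution_le (H := fun ξ => inner ℝ ξ v) (L := ‖v‖) ?_ ?_ ?_ hu ?_ ht.le ?_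
  · intro r _ ξ
    rw [real_inner_smul_left]
  · intro ξ ζ
    rw [inner_add_left]
  · intro ξ
    rw [mul_comm]
    exact abs_real_inner_le_norm ξ v
  · intro φ hφ z s hs hmax
    have h1 := hsub φ hφ z s hs hmax
    have h2 := hvΦ (-gradient (fun y => φ (y, s)) z)
    rw [inner_neg_left, map_neg_eq_map] at h2
    linarith
  · intro z hz
    refine ⟨z - y, ?_⟩
    have hne : z - y ≠ 0 := fun h => by
      rw [sub_eq_zero.1 h] at hz
      exact lt_irrefl _ hz
    have h1 : 0 < inner ℝ (z - y) (z - y) := real_inner_self_pos.2 hne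
    rw [← real_inner_smul_right, htv]
    have h2 : z - x = (z - y) + (y - x) := by abel
    rw [h2, inner_add_right]
    linarith

/-- The negative of a supersolution for the speed `c` is a subsolution for the speed `-c`. -/
theorem IsViscositySuper.neg {Φ : Seminorm ℝ (EuclideanSpace ℝ (Fin N))} {c : ℝ}
    {u : EuclideanSpace ℝ (Fin N) → ℝ → ℝ} (h : IsViscositySuper Φ c u) :
    IsViscositySub Φ (-c) fun x t => -u x t := by
  intro φ hφ x t ht hmax
  have h1 := h (fun z => -φ z) hφ.neg x t ht (by
    have := hmax.neg
    refine this.congr (Filter.Eventually.of_forall fun z => ?_)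
    simp; ring)
  have h2 : gradient (fun y => -φ (y, t)) x = -gradient (fun y => φ (y, t)) x := by
    simp [gradient, fderiv_fun_neg]
  rw [h2, map_neg_eq_map, deriv.fun_neg] at h1
  linarith

/-! ### Ordered initial data and the geometry of nested sets -/

theorem truncDist_anti (Φ : Seminorm ℝ (EuclideanSpace ℝ (Fin N))) (η : ℝ)
    {C D : Set (EuclideanSpace ℝ (Fin N))} (h : C ⊆ D) (x : EuclideanSpace ℝ (Fin N)) :
    truncDist Φ η D x ≤ truncDist Φ η C x := by
  have hmono : ∀ {A B : Set (EuclideanSpace ℝ (Fin N))}, A ⊆ B →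
      (distPt Φ x B : EReal) ≤ distPt Φ x A := fun hAB =>
    EReal.coe_ennreal_le_coe_ennreal_iff.2 (biInf_mono hAB)
  refine EReal.toReal_le_toReal ?_ ?_ ?_
  · exact max_le_max le_rfl (min_le_min le_rfl
      (EReal.sub_le_sub (hmono h) (hmono (compl_subset_compl.2 h))))
  -- Truncation keeps the values finite, which makes `toReal` monotone here.
  · exact ne_bot_of_le_ne_bot (EReal.coe_ne_bot (-η)) (by simp)
  · exact ne_top_of_le_ne_top (EReal.coe_ne_top (max (-η) η)) (by
      refine max_le (by exact_mod_cast le_max_left (-η) η) ((min_le_left _ _).trans ?_)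
      exact_mod_cast le_max_right (-η) η)

theorem exists_polar_split {Φ : Seminorm ℝ (EuclideanSpace ℝ (Fin N))}
    (hΦ : ∀ p : EuclideanSpace ℝ (Fin N), p ≠ 0 → 0 < Φ p) (x y : EuclideanSpace ℝ (Fin N))
    {r : ℝ} (hr : 0 ≤ r) (hrD : r ≤ polar Φ (y - x)) :
    ∃ z, polar Φ (z - x) ≤ r ∧ polar Φ (y - z) ≤ polar Φ (y - x) - r := by
  rcases (polar_nonneg Φ (y - x)).eq_or_lt with hD | hD
  · obtain rfl : r = 0 := by linarith
    exact ⟨x, by simpa using polar_smul_le hΦ le_rfl (0 : EuclideanSpace ℝ (Fin N)), by simp⟩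
  · set s := r / polar Φ (y - x) with hs
    have hsD : s * polar Φ (y - x) = r := by rw [hs, div_mul_cancel₀ _ hD.ne']
    have hs0 : 0 ≤ s := by positivity
    have hs1 : s ≤ 1 := (div_le_one hD).2 hrD
    refine ⟨x + s • (y - x), ?_, ?_⟩
    · rw [add_sub_cancel_left]
      exact (polar_smul_le hΦ hs0 _).trans hsD.le
    · have h : y - (x + s • (y - x)) = (1 - s) • (y - x) := by module
      rw [h]
      refine (polar_smul_le hΦ (sub_nonneg.2 hs1) _).trans_eq ?_
      rw [sub_mul, hsD, one_mul]

theorem exists_mem_frontier_of_segment {K : Set (EuclideanSpace ℝ (Fin N))}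
    {x y : EuclideanSpace ℝ (Fin N)} (hx : x ∈ K) (hy : y ∉ K) :
    ∃ s ∈ Icc (0 : ℝ) 1, x + s • (y - x) ∈ frontier K := by
  have hf : Continuous fun s : unitInterval => x + (s : ℝ) • (y - x) := by fun_prop
  obtain ⟨s, hs⟩ := (nonempty_frontier_iff
    (s := (fun s : unitInterval => x + (s : ℝ) • (y - x)) ⁻¹' K)).2
    ⟨⟨0, by simpa using hx⟩, fun h => hy (by
      have : (1 : unitInterval) ∈ (fun s : unitInterval => x + (s : ℝ) • (y - x)) ⁻¹' K := by
        rw [h]; trivial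
      simpa using this)⟩
  exact ⟨s, s.2, hf.frontier_preimage_subset K hs⟩

/-- The segment from `x` to `y` leaves both sets, and two of its points are no farther apart than
its ends. -/
theorem distSets_frontier_le {Φ : Seminorm ℝ (EuclideanSpace ℝ (Fin N))}
    (hΦ : ∀ p : EuclideanSpace ℝ (Fin N), p ≠ 0 → 0 < Φ p)
    {K₁ K₂ : Set (EuclideanSpace ℝ (Fin N))} (hK : K₂ ⊆ K₁) {x y : EuclideanSpace ℝ (Fin N)}
    (hx : x ∈ K₂) (hy : y ∉ K₁) :
    distSets Φ (frontier K₁) (frontier K₂) ≤ ENNReal.ofReal (polar Φ (y - x)) := by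
  obtain ⟨s, hs, hsK⟩ := exists_mem_frontier_of_segment (hK hx) hy
  obtain ⟨r, hr, hrK⟩ := exists_mem_frontier_of_segment hx fun h => hy (hK h)
  refine (iInf₂_le_of_le _ hsK (iInf₂_le _ hrK)).trans (ENNReal.ofReal_le_ofReal ?_)
  have hle : ∀ {a b : ℝ}, a ∈ Icc (0 : ℝ) 1 → b ∈ Icc (0 : ℝ) 1 → b ≤ a →
      polar Φ (x + a • (y - x) - (x + b • (y - x))) ≤ polar Φ (y - x) := by
    intro a b ha hb hba
    have h : x + a • (y - x) - (x + b • (y - x)) = (a - b) • (y - x) := by module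
    rw [h]
    exact (polar_smul_le hΦ (sub_nonneg.2 hba) _).trans
      (mul_le_of_le_one_left (polar_nonneg _ _) (by linarith [ha.2, hb.1]))
  rcases le_total r s with h | h
  · exact hle hs hr h
  · rw [polar_sub_comm hΦ]
    exact hle hr hs h

/-- Moving the two points of a pair `x ∈ K₂`, `y ∉ K₁` found at a later time back to the initial
sets; `a` and `b` are the signed displacements of `K₂` and of the complement of `K₁`. -/
theorem exists_pair_of_displacement {Φ : Seminorm ℝ (EuclideanSpace ℝ (Fin N))}
    (hΦ : ∀ p : EuclideanSpace ℝ (Fin N), p ≠ 0 → 0 < Φ p)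
    {K₁ K₂ : Set (EuclideanSpace ℝ (Fin N))} (hK : K₂ ⊆ K₁) {x y : EuclideanSpace ℝ (Fin N)}
    {a b : ℝ}
    (hx : (0 ≤ a ∧ ∃ x', polar Φ (x' - x) ≤ a ∧ x' ∈ K₂) ∨
      (a ≤ 0 ∧ ∀ x', polar Φ (x' - x) ≤ -a → x' ∈ K₂))
    (hy : (0 ≤ b ∧ ∃ y', polar Φ (y' - y) ≤ b ∧ y' ∉ K₁) ∨
      (b ≤ 0 ∧ ∀ y', polar Φ (y' - y) ≤ -b → y' ∉ K₁)) :
    ∃ x' ∈ K₂, ∃ y', y' ∉ K₁ ∧ polar Φ (y' - x') ≤ polar Φ (y - x) + a + b := by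
  have hself : ∀ z : EuclideanSpace ℝ (Fin N), polar Φ (z - z) = 0 := fun z =>
    le_antisymm (by simpa using polar_smul_le hΦ le_rfl z) (polar_nonneg _ _)
  have moveY : ∀ x' ∈ K₂, polar Φ (y - x') ≤ polar Φ (y - x) + a →
      ∃ x' ∈ K₂, ∃ y', y' ∉ K₁ ∧ polar Φ (y' - x') ≤ polar Φ (y - x) + a + b := by
    intro x' hx' hD
    rcases hy with ⟨_, y', hy', hyK⟩ | ⟨hb, hball⟩
    · exact ⟨x', hx', y', hyK, by linarith [polar_sub_le hΦ y' y x']⟩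
    -- The ball about `y` misses `K₁`, hence `x'`; walking from `y` towards `x'` gains the full
    -- radius.
    · have hfar : -b ≤ polar Φ (x' - y) := by
        by_contra! h
        exact hball x' h.le (hK hx')
      obtain ⟨z, hz1, hz2⟩ := exists_polar_split hΦ y x' (neg_nonneg.2 hb) hfar
      rw [polar_sub_comm hΦ x' y, polar_sub_comm hΦ x' z] at hz2
      exact ⟨x', hx', z, hball z hz1, by linarith⟩
  rcases hx with ⟨_, x', hx', hxK⟩ | ⟨ha, hball⟩
  · refine moveY x' hxK ?_
    rw [polar_sub_comm hΦ] at hx'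
    linarith [polar_sub_le hΦ y x x']
  · have moveX : ∀ y', y' ∉ K₁ → ∃ x' ∈ K₂, polar Φ (y' - x') ≤ polar Φ (y' - x) + a := by
      intro y' hy'
      have hfar : -a ≤ polar Φ (y' - x) := by
        by_contra! h
        exact hy' (hK (hball y' h.le))
      obtain ⟨z, hz1, hz2⟩ := exists_polar_split hΦ x y' (neg_nonneg.2 ha) hfar
      exact ⟨z, hball z hz1, by linarith⟩
    -- A point that may increase the distance is moved first; the ball about the other is then used
    -- against its new position.
    rcases hy with ⟨_, y', hy', hyK⟩ | ⟨hb, hbally⟩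
    · obtain ⟨x', hx', hD⟩ := moveX y' hyK
      exact ⟨x', hx', y', hyK, by linarith [polar_sub_le hΦ y' y x]⟩
    · obtain ⟨x', hx', hD⟩ := moveX y (hbally y ((hself y).trans_le (neg_nonneg.2 hb)))
      exact moveY x' hx' hD

/-! ### The estimate for the fronts -/

theorem frontDist_zero_le {Φ : Seminorm ℝ (EuclideanSpace ℝ (Fin N))}
    (hΦ : ∀ p : EuclideanSpace ℝ (Fin N), p ≠ 0 → 0 < Φ p) {c₁ c₂ : ℝ}
    {u₁ u₂ : EuclideanSpace ℝ (Fin N) → ℝ → ℝ}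
    (hu₁ : ContinuousOn (fun z : EuclideanSpace ℝ (Fin N) × ℝ => u₁ z.1 z.2) (univ ×ˢ Ici 0))
    (hsuper : IsViscositySuper Φ c₁ u₁)
    (hu₂ : ContinuousOn (fun z : EuclideanSpace ℝ (Fin N) × ℝ => u₂ z.1 z.2) (univ ×ˢ Ici 0))
    (hsub : IsViscositySub Φ c₂ u₂) (hle : ∀ x, u₂ x 0 ≤ u₁ x 0) {t : ℝ} (ht : 0 ≤ t)
    {x y : EuclideanSpace ℝ (Fin N)} (hx : x ∈ levelSet u₂ t) (hy : y ∉ levelSet u₁ t) :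
    0 ≤ polar Φ (y - x) + t * (c₂ - c₁) ∧
      frontDist Φ u₁ u₂ 0 ≤ ENNReal.ofReal (polar Φ (y - x) + t * (c₂ - c₁)) := by
  have hK : levelSet u₂ 0 ⊆ levelSet u₁ 0 := fun z hz => le_trans hz (hle z)
  have hy' : u₁ y t < 0 := not_le.1 hy
  have hw : ContinuousOn (fun z : EuclideanSpace ℝ (Fin N) × ℝ => -u₁ z.1 z.2) (univ ×ˢ Ici 0) :=
    hu₁.neg
  obtain ⟨x', hx', y', hy', h⟩ := exists_pair_of_displacement hΦ hK (x := x) (y := y)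
    (a := c₂ * t) (b := -c₁ * t) (by
      rcases le_total 0 c₂ with hc | hc
      · obtain ⟨x', h1, h2⟩ := exists_le_initial_of_sub hΦ hc hu₂ hsub x ht
        exact .inl ⟨mul_nonneg hc ht, x', h1, le_trans hx h2⟩
      · exact .inr ⟨mul_nonpos_of_nonpos_of_nonneg hc ht, fun x' h1 =>
          le_trans hx (le_initial_of_sub hΦ hc hu₂ hsub ht (by linarith))⟩) (by
      rcases le_total 0 (-c₁) with hc | hc
      · obtain ⟨y', h1, h2⟩ := exists_le_initial_of_sub hΦ hc hw hsuper.neg y ht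
        exact .inl ⟨mul_nonneg hc ht, y', h1, fun h : 0 ≤ u₁ y' 0 => by linarith⟩
      · refine .inr ⟨mul_nonpos_of_nonpos_of_nonneg hc ht, fun y' h1 (h : 0 ≤ u₁ y' 0) => ?_⟩
        have h2 := le_initial_of_sub hΦ hc hw hsuper.neg ht (h1.trans_eq (by ring))
        linarith)
  exact ⟨by linarith [polar_nonneg Φ (y' - x')],
    (distSets_frontier_le hΦ hK hx' hy').trans (ENNReal.ofReal_le_ofReal (by linarith))⟩

end ConstSpeed

theorem lemma6p1 {N : ℕ} (Φ : Seminorm ℝ (EuclideanSpace ℝ (Fin N)))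
    (hΦ : ∀ p : EuclideanSpace ℝ (Fin N), p ≠ 0 → 0 < Φ p)
    (C₁ C₂ : Set (EuclideanSpace ℝ (Fin N))) (hC : C₁ ⊆ C₂)
    (η : ℝ) (hη : 0 < η) (c₁ c₂ : ℝ)
    (u₁ u₂ : EuclideanSpace ℝ (Fin N) → ℝ → ℝ)
    (hu₁ : ConstSpeed.IsViscositySolution Φ c₁ (ConstSpeed.truncDist Φ η C₁) u₁)
    (hu₂ : ConstSpeed.IsViscositySolution Φ c₂ (ConstSpeed.truncDist Φ η C₂) u₂)
    (t : ℝ) (ht : 0 ≤ t)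
    (htS : ENNReal.ofReal t ≤ ConstSpeed.contactTime (ConstSpeed.frontDist Φ u₁ u₂)) :
    (ConstSpeed.frontDist Φ u₁ u₂ 0 : EReal) - ((t * (c₂ - c₁) : ℝ) : EReal) ≤
      (ConstSpeed.frontDist Φ u₁ u₂ t : EReal) := by
  open ConstSpeed in
  have hle : ∀ x, u₂ x 0 ≤ u₁ x 0 := fun x => by
    rw [hu₁.initial, hu₂.initial]
    exact truncDist_anti Φ η hC x
  have hclosed : IsClosed (levelSet u₂ t) :=
    isClosed_le continuous_const (continuous_slice hu₂.continuousOn ht)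
  obtain ⟨A, hA, hAb⟩ := exists_polar_le_norm hΦ
  have hreal : ∀ y ∈ frontier (levelSet u₁ t), ∀ x ∈ frontier (levelSet u₂ t),
      (frontDist Φ u₁ u₂ 0 : EReal) - ((t * (c₂ - c₁) : ℝ) : EReal) ≤
        ((polar Φ (y - x) : ℝ) : EReal) := by
    intro y hy x hx
    have hx' : x ∈ levelSet u₂ t := hclosed.frontier_subset hx
    have hy' : y ∈ closure (levelSet u₁ t)ᶜ := by
      rw [frontier_eq_closure_inter_closure] at hy
      exact hy.2
    -- A point of the front of `u₁` need only be a limit of points where `u₁ < 0`.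
    have happrox : ∀ ε : ℝ, 0 < ε → ∃ y', polar Φ (y' - x) ≤ polar Φ (y - x) + ε ∧
        0 ≤ polar Φ (y' - x) + t * (c₂ - c₁) ∧
        frontDist Φ u₁ u₂ 0 ≤ ENNReal.ofReal (polar Φ (y' - x) + t * (c₂ - c₁)) := by
      intro ε hε
      obtain ⟨y', hy', hd⟩ := Metric.mem_closure_iff.1 hy' (ε / (A + 1)) (by positivity)
      refine ⟨y', ?_, frontDist_zero_le hΦ hu₁.continuousOn hu₁.super hu₂.continuousOn hu₂.sub
        hle ht hx' hy'⟩
      have h1 := hAb (y' - y)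
      rw [← dist_eq_norm, dist_comm] at h1
      rw [lt_div_iff₀ (by positivity)] at hd
      have h2 : polar Φ (y' - y) ≤ ε := by nlinarith [dist_nonneg (x := y) (y := y')]
      linarith [polar_sub_le hΦ y' y x]
    have hlim : frontDist Φ u₁ u₂ 0 ≤ ENNReal.ofReal (polar Φ (y - x) + t * (c₂ - c₁)) := by
      have hcont : Filter.Tendsto
          (fun ε : ℝ => ENNReal.ofReal (polar Φ (y - x) + ε + t * (c₂ - c₁))) (𝓝[>] 0)
          (𝓝 (ENNReal.ofReal (polar Φ (y - x) + 0 + t * (c₂ - c₁)))) := by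
        have h : Continuous fun ε : ℝ =>
            ENNReal.ofReal (polar Φ (y - x) + ε + t * (c₂ - c₁)) :=
          ENNReal.continuous_ofReal.comp (by fun_prop)
        exact (h.tendsto 0).mono_left nhdsWithin_le_nhds
      rw [add_zero] at hcont
      refine ge_of_tendsto hcont ?_
      filter_upwards [self_mem_nhdsWithin] with ε hε
      obtain ⟨y', h1, _, h2⟩ := happrox ε hε
      exact h2.trans (ENNReal.ofReal_le_ofReal (by linarith))
    -- `ENNReal.ofReal` cuts negative values to `0`, so the sign is needed to return to `EReal`.
    have hnonneg : 0 ≤ polar Φ (y - x) + t * (c₂ - c₁) :=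
      le_of_forall_pos_le_add fun ε hε => by
        obtain ⟨y', h1, h2, _⟩ := happrox ε hε
        linarith
    refine EReal.sub_le_of_le_add ?_
    have h := EReal.coe_ennreal_le_coe_ennreal_iff.2 hlim
    rwa [EReal.coe_ennreal_ofReal, max_eq_left hnonneg, EReal.coe_add] at h
  -- Replacing the left side by its positive part moves the inequality to `ℝ≥0∞`, where the infimum
  -- is taken; an empty front gives `∞`.
  refine (le_max_right 0 _).trans (EReal.coe_toENNReal_eq_max.symm.trans_le ?_)
  refine EReal.coe_ennreal_le_coe_ennreal_iff.2 (le_iInf₂ fun y hy => le_iInf₂ fun x hx => ?_)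
  exact EReal.toENNReal_le_toENNReal (hreal y hy x hx)
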